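/- Let $M$ be a smooth ($C^\infty$) manifold of dimension $m$ without boundary, with tangent bundle $\pi:TM\to M$, and let $\Omega^p_M$, $\Omega^p_{TM}$ be the real vector spaces of smooth differential $p$-forms on $M$ and on the manifold $TM$. Let $B$ be the mirror map (canonical endomorphism) of $T(TM)$: for $u\in TM$ and $w\in T_u(TM)$, $B_u(w)=\frac{\mathrm d}{\mathrm dt}\big|_{t=0}\bigl(u+t\,\mathrm d\pi_u(w)\bigr)$; in the charts $(x^i,v^i)$ of $TM$ induced by charts of $M$, $B=\sum_j \mathrm dx^j\otimes\partial_{v^j}$. For $\omega\in\Omega^p_{TM}$ put $$(\mathrm i_B\omega)(X_1,\dots,X_p)=\sum_{k=1}^p\omega(X_1,\dots,BX_k,\dots,X_p),\qquad \mathrm d_B=\mathrm i_B\circ\mathrm d-\mathrm d\circ\mathrm i_B:\Omega^p_{TM}\to\Omega^{p+1}_{TM},$$ with $\mathrm i_B=0$ on functions. For $q\ge 2$ let $$H^q_{\mathrm d\mathrm d_B}(TM)=\frac{\{\omega\in\Omega^q_{TM}:\ \mathrm d\omega=\mathrm d_B\omega=0\}}{\{\mathrm d\,\mathrm d_B\tau:\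 \tau\in\Omega^{q-2}_{TM}\}},$$ and let $H^q(M)$ be the de Rham cohomology of $M$. **Theorem.** For every $q\ge2$ the map $$H^q(M)\longrightarrow H^q_{\mathrm d\mathrm d_B}(TM),\qquad [\omega]\longmapsto[\pi^*\omega],$$ is well defined (and linear): if $\omega\in\Omega^q_M$ is closed then $\mathrm d\pi^*\omega=\mathrm d_B\pi^*\omega=0$, and the class of $\pi^*\omega$ in $H^q_{\mathrm d\mathrm d_B}(TM)$ depends only on the de Rham class of $\omega$. -/

import Mathlib

open Set Filter Topology Manifold Bundle
open scoped ContDiff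

noncomputable section

namespace TangentCohomology

/-! ### Multilinear algebra -/

section Algebra

variable {V W : Type*} [AddCommGroup V] [Module ℝ V] [TopologicalSpace V]
  [AddCommGroup W] [Module ℝ W] [TopologicalSpace W] {n : ℕ}

theorem sum_update_eq_zero (K : V →L[ℝ] V) (α : V [⋀^Fin n]→L[ℝ] ℝ) (v : Fin n → V)
    {a b : Fin n} (heq : v a = v b) (hne : a ≠ b) :
    ∑ i, α (Function.update v i (K (v i))) = 0 := by
  rw [← Finset.sum_add_sum_compl {a, b}, Finset.sum_pair hne, Finset.sum_eq_zero, add_zero]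
  · have h1 : Function.update v b (K (v b)) =
        (Function.update v a (K (v a))) ∘ (Equiv.swap a b) := by
      ext j
      rcases eq_or_ne j a with rfl | hja
      · simp [heq, hne, hne.symm]
      · rcases eq_or_ne j b with rfl | hjb
        · simp [heq]
        · simp [Equiv.swap_apply_of_ne_of_ne, *]
    rw [h1]
    exact α.map_add_swap _ hne
  · simp only [Finset.mem_compl, Finset.mem_insert, Finset.mem_singleton, not_or, and_imp]
    intro i hia hib
    refine α.map_eq_zero_of_eq _ ?_ hne
    simp [*, Ne.symm]

theorem sum_compContinuousLinearMap_apply (K : V →L[ℝ] V) (α : V [⋀^Fin n]→L[ℝ] ℝ)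
    (v : Fin n → V) :
    (∑ i : Fin n, α.toContinuousMultilinearMap.compContinuousLinearMap
      (Function.update (fun _ => ContinuousLinearMap.id ℝ V) i K)) v =
      ∑ i, α (Function.update v i (K (v i))) := by
  rw [sum_apply]
  refine Finset.sum_congr rfl fun i _ => ?_
  change α _ = α _
  congr 1
  ext j
  rcases eq_or_ne j i with rfl | h
  · simp
  · simp [h]

/-- The algebraic derivation `i_K` on alternating forms given by an endomorphism `K`:
`(i_K α)(v₁, …, v_p) = ∑ᵢ α(v₁, …, K vᵢ, …, v_p)`. It is `0` in degree `0`. -/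
def insertEnd (K : V →L[ℝ] V) (α : V [⋀^Fin n]→L[ℝ] ℝ) : V [⋀^Fin n]→L[ℝ] ℝ :=
  { (∑ i : Fin n, α.toContinuousMultilinearMap.compContinuousLinearMap
      (Function.update (fun _ => ContinuousLinearMap.id ℝ V) i K)) with
    map_eq_zero_of_eq' := fun v _ _ heq hne =>
      (sum_compContinuousLinearMap_apply K α v).trans (sum_update_eq_zero K α v heq hne) }

theorem insertEnd_apply (K : V →L[ℝ] V) (α : V [⋀^Fin n]→L[ℝ] ℝ) (v : Fin n → V) :
    insertEnd K α v = ∑ i, α (Function.update v i (K (v i))) :=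
  sum_compContinuousLinearMap_apply K α v

theorem insertEnd_comp (K : V →L[ℝ] V) (L : W →L[ℝ] W) (S : W →L[ℝ] V)
    (h : ∀ w, K (S w) = S (L w)) (α : V [⋀^Fin n]→L[ℝ] ℝ) :
    (insertEnd K α).compContinuousLinearMap S = insertEnd L (α.compContinuousLinearMap S) := by
  ext v
  simp only [insertEnd_apply, ContinuousAlternatingMap.compContinuousLinearMap_apply,
    Function.comp_def, h]
  refine Finset.sum_congr rfl fun i _ => ?_
  congr 1
  ext j
  rcases eq_or_ne j i with rfl | h
  · simp
  · simp [h]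

end Algebra

section Normed

variable {E F : Type*} [NormedAddCommGroup E] [NormedSpace ℝ E]
  [NormedAddCommGroup F] [NormedSpace ℝ F] {n : ℕ}

theorem insertEnd_eq_fderivComp (K : E →L[ℝ] E) (α : E [⋀^Fin n]→L[ℝ] ℝ) :
    insertEnd K α =
      ContinuousAlternatingMap.fderivCompContinuousLinearMapCLM ℝ (ContinuousLinearMap.id ℝ E)
        α K := by
  ext v
  rw [insertEnd_apply]
  change _ = α.fderivCompContinuousLinearMap _ _ _
  rw [ContinuousAlternatingMap.fderivCompContinuousLinearMap_apply]
  refine Finset.sum_congr rfl fun i _ => ?_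
  congr 1
  ext j
  rcases eq_or_ne j i with rfl | h
  · simp
  · simp [h]

/-- Normalized antisymmetrization, a continuous left inverse of the inclusion of alternating maps
into multilinear maps. -/
def altProj : ContinuousMultilinearMap ℝ (fun _ : Fin n => E) ℝ →L[ℝ] E [⋀^Fin n]→L[ℝ] ℝ :=
  LinearMap.mkContinuous
    { toFun := fun f => (n.factorial : ℝ)⁻¹ • ContinuousMultilinearMap.alternatization f
      map_add' := fun f g => by rw [map_add, smul_add]
      map_smul' := fun c f => by
        ext v
        simp [ContinuousMultilinearMap.alternatization_apply_apply, Finset.mul_sum,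
          Units.smul_def, mul_left_comm] }
    1 fun f => by
      refine ContinuousAlternatingMap.opNorm_le_bound _ (by positivity) fun v => ?_
      simp only [LinearMap.coe_mk, AddHom.coe_mk, ContinuousAlternatingMap.smul_apply,
        ContinuousMultilinearMap.alternatization_apply_apply, norm_smul]
      have h : ‖∑ σ : Equiv.Perm (Fin n), Equiv.Perm.sign σ • f (v ∘ σ)‖
          ≤ (n.factorial : ℝ) * (‖f‖ * ∏ i, ‖v i‖) := by
        refine (norm_sum_le _ _).trans ?_
        have : ∀ σ ∈ (Finset.univ : Finset (Equiv.Perm (Fin n))),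
            ‖Equiv.Perm.sign σ • f (v ∘ σ)‖ ≤ ‖f‖ * ∏ i, ‖v i‖ := by
          intro σ _
          have h1 : ‖Equiv.Perm.sign σ • f (v ∘ σ)‖ = ‖f (v ∘ σ)‖ := by
            rcases Int.units_eq_one_or (Equiv.Perm.sign σ) with h | h <;> simp [h]
          rw [h1]
          refine (f.le_opNorm _).trans_eq ?_
          congr 1
          exact Equiv.prod_comp σ (fun i => ‖v i‖)
        refine (Finset.sum_le_sum this).trans_eq ?_
        simp [Fintype.card_perm]
      have hn : (0 : ℝ) < n.factorial := by exact_mod_cast n.factorial_pos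
      rw [norm_inv, Real.norm_of_nonneg hn.le, one_mul, inv_mul_le_iff₀ hn]
      exact h

theorem altProj_toContinuousMultilinearMap (α : E [⋀^Fin n]→L[ℝ] ℝ) :
    altProj α.toContinuousMultilinearMap = α := by
  ext v
  change (n.factorial : ℝ)⁻¹ • (ContinuousMultilinearMap.alternatization
    α.toContinuousMultilinearMap v) = _
  rw [ContinuousMultilinearMap.alternatization_apply_apply]
  have : ∀ σ : Equiv.Perm (Fin n),
      Equiv.Perm.sign σ • α.toContinuousMultilinearMap (v ∘ σ) = α v := by
    intro σ
    change Equiv.Perm.sign σ • α.toAlternatingMap (v ∘ σ) = α v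
    rw [AlternatingMap.map_perm, smul_smul]
    simp
  have hn : (n.factorial : ℝ) ≠ 0 := by exact_mod_cast n.factorial_ne_zero
  rw [Finset.sum_congr rfl fun σ _ => this σ]
  simp [Fintype.card_perm, hn]

theorem contDiff_compContinuousLinearMap :
    ContDiff ℝ ∞ (fun p : (F [⋀^Fin n]→L[ℝ] ℝ) × (E →L[ℝ] F) =>
      p.1.compContinuousLinearMap p.2) := by
  have h1 : ContDiff ℝ ∞ (fun p : (F [⋀^Fin n]→L[ℝ] ℝ) × (E →L[ℝ] F) =>
      (ContinuousMultilinearMap.compContinuousLinearMapContinuousMultilinear ℝ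
        (fun _ : Fin n => E) (fun _ : Fin n => F) ℝ) (fun _ => p.2)
        (ContinuousAlternatingMap.toContinuousMultilinearMapCLM ℝ p.1)) := by
    refine ContDiff.clm_apply ?_ ?_
    · exact (ContinuousMultilinearMap.contDiff _).comp (contDiff_pi.2 fun _ => contDiff_snd)
    · exact (ContinuousLinearMap.contDiff _).comp contDiff_fst
  convert (altProj (E := E) (n := n)).contDiff.comp h1 using 1
  funext p
  rw [← altProj_toContinuousMultilinearMap (p.1.compContinuousLinearMap p.2)]
  rfl

end Normed

/-! ### Differential forms on manifolds without boundary -/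

section Forms

variable {E : Type*} [NormedAddCommGroup E] [NormedSpace ℝ E]
  {H : Type*} [TopologicalSpace H] (I : ModelWithCorners ℝ E H)
  {M : Type*} [TopologicalSpace M] [ChartedSpace H M]
  {E' : Type*} [NormedAddCommGroup E'] [NormedSpace ℝ E']
  {H' : Type*} [TopologicalSpace H'] (J : ModelWithCorners ℝ E' H')
  {N : Type*} [TopologicalSpace N] [ChartedSpace H' N] {n : ℕ}

/-- The expression of a field of alternating `n`-forms in the chart at `x₀`: its pullback by the
inverse of the chart. -/
def chartRep (x₀ : M) (α : ∀ x : M, TangentSpace I x [⋀^Fin n]→L[ℝ] ℝ) (y : E) :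
    E [⋀^Fin n]→L[ℝ] ℝ :=
  (α ((extChartAt I x₀).symm y)).compContinuousLinearMap
    (mfderiv 𝓘(ℝ, E) I (extChartAt I x₀).symm y)

theorem chartRep_add (x₀ : M) (α β : ∀ x : M, TangentSpace I x [⋀^Fin n]→L[ℝ] ℝ) :
    chartRep I x₀ (α + β) = chartRep I x₀ α + chartRep I x₀ β := rfl

theorem chartRep_smul (x₀ : M) (c : ℝ) (α : ∀ x : M, TangentSpace I x [⋀^Fin n]→L[ℝ] ℝ) :
    chartRep I x₀ (c • α) = c • chartRep I x₀ α := rfl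

variable (M) in
/-- The smooth differential `n`-forms on `M`: fields of alternating forms on the tangent spaces
whose expression in every chart is smooth. -/
def smoothForms (n : ℕ) :
    Submodule ℝ (∀ x : M, TangentSpace I x [⋀^Fin n]→L[ℝ] ℝ) where
  carrier := {α | ∀ x₀ : M, ContDiffOn ℝ ∞ (chartRep I x₀ α) (extChartAt I x₀).target}
  add_mem' := fun ha hb x₀ => (ha x₀).add (hb x₀)
  zero_mem' := fun x₀ => by
    have : chartRep I x₀ (0 : ∀ x : M, TangentSpace I x [⋀^Fin n]→L[ℝ] ℝ) = fun _ => 0 := rfl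
    rw [this]
    exact contDiffOn_const
  smul_mem' := fun c α h x₀ => (h x₀).const_smul c

variable (M) in
/-- The real vector space `Ωⁿ(M)` of smooth differential `n`-forms on `M`. -/
def DifferentialForm (n : ℕ) : Type _ := smoothForms I M n

instance (n : ℕ) : AddCommGroup (DifferentialForm I M n) :=
  inferInstanceAs (AddCommGroup (smoothForms I M n))

instance (n : ℕ) : Module ℝ (DifferentialForm I M n) :=
  inferInstanceAs (Module ℝ (smoothForms I M n))

/-- The exterior derivative at `x`, computed in the chart at `x`. -/
def extDerivAt (α : ∀ x : M, TangentSpace I x [⋀^Fin n]→L[ℝ] ℝ) (x : M) :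
    TangentSpace I x [⋀^Fin (n + 1)]→L[ℝ] ℝ :=
  (extDeriv (chartRep I x α) (extChartAt I x x)).compContinuousLinearMap
    (mfderiv I 𝓘(ℝ, E) (extChartAt I x) x)

variable {I J}

theorem apply_congr_point {x x' : M} (h : x = x')
    (α : ∀ x : M, TangentSpace I x [⋀^Fin n]→L[ℝ] ℝ) (v : Fin n → E) :
    (α x : E [⋀^Fin n]→L[ℝ] ℝ) v = (α x' : E [⋀^Fin n]→L[ℝ] ℝ) v := by
  subst h; rfl

variable [IsManifold I ∞ M] [I.Boundaryless] [IsManifold J ∞ N] [J.Boundaryless]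

theorem mdifferentiableAt_symm {x₀ : M} {y : E} (hy : y ∈ (extChartAt I x₀).target) :
    MDifferentiableAt 𝓘(ℝ, E) I (extChartAt I x₀).symm y := by
  have := mdifferentiableWithinAt_extChartAt_symm hy
  rwa [I.range_eq_univ, mdifferentiableWithinAt_univ] at this

/-- The pullback of a field of forms by a map from a vector space, computed in a chart. -/
theorem comp_mfderiv_eq {α : ∀ x : M, TangentSpace I x [⋀^Fin n]→L[ℝ] ℝ}
    {g : E' → M} {y : E'} {x₁ : M} (hg : MDifferentiableAt 𝓘(ℝ, E') I g y)
    (hy : g y ∈ (extChartAt I x₁).source) :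
    ((α (g y)).compContinuousLinearMap (mfderiv 𝓘(ℝ, E') I g y) : E' [⋀^Fin n]→L[ℝ] ℝ) =
      (chartRep I x₁ α (extChartAt I x₁ (g y))).compContinuousLinearMap
        (fderiv ℝ (extChartAt I x₁ ∘ g) y) := by
  have hs : g ⁻¹' (extChartAt I x₁).source ∈ 𝓝 y :=
    hg.continuousAt.preimage_mem_nhds (extChartAt_source_mem_nhds' hy)
  have hφ : MDifferentiableAt 𝓘(ℝ, E') 𝓘(ℝ, E) (extChartAt I x₁ ∘ g) y :=
    (mdifferentiableAt_extChartAt (by simpa using hy)).comp y hg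
  have heq : g =ᶠ[𝓝 y] (extChartAt I x₁).symm ∘ (extChartAt I x₁ ∘ g) := by
    filter_upwards [hs] with z hz
    exact ((extChartAt I x₁).left_inv hz).symm
  have h1 := heq.mfderiv_eq (I := 𝓘(ℝ, E')) (I' := I)
  have h2 := mfderiv_comp y
    (mdifferentiableAt_symm ((extChartAt I x₁).map_source hy)) hφ
  ext v
  rw [h1]
  change (α (g y) : E [⋀^Fin n]→L[ℝ] ℝ) _ = (α _ : E [⋀^Fin n]→L[ℝ] ℝ) _
  refine (apply_congr_point ((extChartAt I x₁).left_inv hy).symm α _).trans ?_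
  refine congrArg (α _ : E [⋀^Fin n]→L[ℝ] ℝ) (funext fun i => ?_)
  rw [← mfderiv_eq_fderiv]
  exact congrArg (fun L : E' →L[ℝ] E => L (v i)) h2

theorem contDiffOn_extChart_comp {g : E' → M} {s : Set E'}
    (hg : ContMDiffOn 𝓘(ℝ, E') I ∞ g s) {x₁ : M} (hs : MapsTo g s (extChartAt I x₁).source) :
    ContDiffOn ℝ ∞ (extChartAt I x₁ ∘ g) s := by
  rw [← contMDiffOn_iff_contDiffOn]
  exact (contMDiffOn_extChartAt (x := x₁)).comp hg (fun z hz => by simpa using hs hz)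

theorem contMDiffOn_symm (x₀ : M) :
    ContMDiffOn 𝓘(ℝ, E) I ∞ (extChartAt I x₀).symm (extChartAt I x₀).target :=
  contMDiffOn_extChartAt_symm x₀

/-- The pullback of a smooth form by a smooth map from an open subset of a vector space. -/
theorem contDiffOn_comp_mfderiv {α : ∀ x : M, TangentSpace I x [⋀^Fin n]→L[ℝ] ℝ}
    (hα : α ∈ smoothForms I M n) {g : E' → M} {s : Set E'} (hs : IsOpen s)
    (hg : ContMDiffOn 𝓘(ℝ, E') I ∞ g s) :
    ContDiffOn ℝ ∞ (fun y => ((α (g y)).compContinuousLinearMap (mfderiv 𝓘(ℝ, E') I g y) :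
      E' [⋀^Fin n]→L[ℝ] ℝ)) s := by
  intro y hy
  set x₁ := g y
  set t := s ∩ g ⁻¹' (extChartAt I x₁).source
  have ht : IsOpen t := hg.continuousOn.isOpen_inter_preimage hs (isOpen_extChartAt_source x₁)
  have hyt : y ∈ t := ⟨hy, mem_extChartAt_source x₁⟩
  have hφ : ContDiffOn ℝ ∞ (extChartAt I x₁ ∘ g) t :=
    contDiffOn_extChart_comp (hg.mono inter_subset_left) fun z hz => hz.2
  have h1 : ContDiffOn ℝ ∞ (fun z => (chartRep I x₁ α (extChartAt I x₁ (g z)))) t :=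
    (hα x₁).comp hφ fun z hz => (extChartAt I x₁).map_source hz.2
  have h2 : ContDiffOn ℝ ∞ (fderiv ℝ (extChartAt I x₁ ∘ g)) t :=
    hφ.fderiv_of_isOpen ht (by simp)
  have h3 := contDiff_compContinuousLinearMap.comp_contDiffOn (h1.prodMk h2)
  have h4 := (h3 y hyt).contDiffAt (ht.mem_nhds hyt)
  refine (h4.congr_of_eventuallyEq ?_).contDiffWithinAt
  filter_upwards [ht.mem_nhds hyt] with z hz
  exact comp_mfderiv_eq (((hg z hz.1).contMDiffAt (hs.mem_nhds hz.1)).mdifferentiableAt (by simp))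
    hz.2

/-- In every chart, the exterior derivative is the exterior derivative of the expression of the
form in that chart. -/
theorem chartRep_extDerivAt {α : ∀ x : M, TangentSpace I x [⋀^Fin n]→L[ℝ] ℝ}
    (hα : α ∈ smoothForms I M n) (x₀ : M) {y : E} (hy : y ∈ (extChartAt I x₀).target) :
    chartRep I x₀ (extDerivAt I α) y = extDeriv (chartRep I x₀ α) y := by
  set p : M := (extChartAt I x₀).symm y with hp
  have ht : IsOpen (extChartAt I x₀).target := isOpen_extChartAt_target x₀
  set φ : E → E := extChartAt I p ∘ (extChartAt I x₀).symm with hφdef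
  set t := (extChartAt I x₀).target ∩ (extChartAt I x₀).symm ⁻¹' (extChartAt I p).source
  have htt : IsOpen t :=
    (contMDiffOn_symm x₀).continuousOn.isOpen_inter_preimage ht (isOpen_extChartAt_source p)
  have hyt : y ∈ t := ⟨hy, mem_extChartAt_source p⟩
  have hφ : ContDiffOn ℝ ∞ φ t :=
    contDiffOn_extChart_comp ((contMDiffOn_symm x₀).mono inter_subset_left) fun z hz => hz.2
  have hev : chartRep I x₀ α =ᶠ[𝓝 y] fun z =>
      (chartRep I p α (φ z)).compContinuousLinearMap (fderiv ℝ φ z) := by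
    filter_upwards [htt.mem_nhds hyt] with z hz
    exact comp_mfderiv_eq (mdifferentiableAt_symm hz.1) hz.2
  rw [hev.extDeriv_eq, extDeriv_pullback (r := ∞)]
  · have hd := mfderiv_comp y (mdifferentiableAt_extChartAt (I := I) (mem_chart_source H p))
      (mdifferentiableAt_symm hy)
    rw [mfderiv_eq_fderiv] at hd
    ext v
    refine congrArg (extDeriv (chartRep I p α) (φ y)) (funext fun i => ?_)
    exact (congrArg (fun L : E →L[ℝ] E => L (v i)) hd).symm
  · exact (((hα p) (φ y) ((extChartAt I p).map_source (mem_extChartAt_source p))).contDiffAt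
      ((isOpen_extChartAt_target p).mem_nhds
        ((extChartAt I p).map_source (mem_extChartAt_source p)))).differentiableAt (by simp)
  · exact (hφ y hyt).contDiffAt (htt.mem_nhds hyt)
  · rw [minSmoothness_of_isRCLikeNormedField]
    exact WithTop.coe_le_coe.2 le_top

theorem differentiableAt_chartRep {α : ∀ x : M, TangentSpace I x [⋀^Fin n]→L[ℝ] ℝ}
    (hα : α ∈ smoothForms I M n) (x : M) :
    DifferentiableAt ℝ (chartRep I x α) (extChartAt I x x) :=
  ((hα x _ (mem_extChartAt_target x)).contDiffAt
    (extChartAt_target_mem_nhds x)).differentiableAt (by simp)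

theorem extDerivAt_mem {α : ∀ x : M, TangentSpace I x [⋀^Fin n]→L[ℝ] ℝ}
    (hα : α ∈ smoothForms I M n) : extDerivAt I α ∈ smoothForms I M (n + 1) := by
  intro x₀
  refine ContDiffOn.congr ?_ fun y hy => chartRep_extDerivAt hα x₀ hy
  exact (ContinuousAlternatingMap.alternatizeUncurryFinCLM ℝ E ℝ).contDiff.comp_contDiffOn
    ((hα x₀).fderiv_of_isOpen (isOpen_extChartAt_target x₀) (m := ∞) le_rfl)

variable (I M) in
/-- The exterior derivative `d : Ωⁿ(M) → Ωⁿ⁺¹(M)`. -/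
def extD (n : ℕ) : DifferentialForm I M n →ₗ[ℝ] DifferentialForm I M (n + 1) where
  toFun α := ⟨extDerivAt I α.1, extDerivAt_mem α.2⟩
  map_add' α β := by
    refine Subtype.ext (funext fun x => ContinuousAlternatingMap.ext fun v => ?_)
    have := extDeriv_add (differentiableAt_chartRep α.2 x) (differentiableAt_chartRep β.2 x)
    exact congrArg (fun A : E [⋀^Fin (n + 1)]→L[ℝ] ℝ =>
      A fun i => mfderiv I 𝓘(ℝ, E) (extChartAt I x) x (v i)) this
  map_smul' c α := by
    refine Subtype.ext (funext fun x => ContinuousAlternatingMap.ext fun v => ?_)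
    have := extDeriv_smul (x := extChartAt I x x) c (chartRep I x α.1)
    exact congrArg (fun A : E [⋀^Fin (n + 1)]→L[ℝ] ℝ =>
      A fun i => mfderiv I 𝓘(ℝ, E) (extChartAt I x) x (v i)) this

/-- The pullback `f^* : Ωⁿ(M) → Ωⁿ(N)` by a smooth map `f : N → M`. -/
def pullbackForm {f : N → M} (hf : ContMDiff J I ∞ f) (n : ℕ) :
    DifferentialForm I M n →ₗ[ℝ] DifferentialForm J N n where
  toFun α := ⟨fun x => (α.1 (f x)).compContinuousLinearMap (mfderiv J I f x), by
    intro x₀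
    refine (contDiffOn_comp_mfderiv α.2 (isOpen_extChartAt_target x₀)
      (hf.comp_contMDiffOn (contMDiffOn_symm x₀))).congr fun y hy => ?_
    have hd := mfderiv_comp y (hf.mdifferentiableAt (by simp)) (mdifferentiableAt_symm hy)
    ext v
    refine congrArg (α.1 _) (funext fun i => ?_)
    exact (congrArg (fun L : E' →L[ℝ] E => L (v i)) hd).symm⟩
  map_add' _ _ := rfl
  map_smul' _ _ := rfl

end Forms

/-! ### Cohomology -/

section DeRham

variable {E : Type*} [NormedAddCommGroup E] [NormedSpace ℝ E]
  {H : Type*} [TopologicalSpace H] (I : ModelWithCorners ℝ E H)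
  (M : Type*) [TopologicalSpace M] [ChartedSpace H M] [IsManifold I ∞ M] [I.Boundaryless]

/-- Closed `q`-forms. -/
def closedForms (q : ℕ) : Submodule ℝ (DifferentialForm I M q) := LinearMap.ker (extD I M q)

/-- Exact `q`-forms. -/
def exactForms : (q : ℕ) → Submodule ℝ (DifferentialForm I M q)
  | 0 => ⊥
  | q + 1 => LinearMap.range (extD I M q)

/-- The de Rham cohomology `H^q(M)`. -/
abbrev DeRhamCohomology (q : ℕ) : Type _ :=
  closedForms I M q ⧸ (exactForms I M q).submoduleOf (closedForms I M q)

end DeRham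

/-! ### The tangent manifold -/

section Tangent

variable {E : Type*} [NormedAddCommGroup E] [NormedSpace ℝ E]
  {H : Type*} [TopologicalSpace H] (I : ModelWithCorners ℝ E H)
  {M : Type*} [TopologicalSpace M] [ChartedSpace H M] [IsManifold I ∞ M]

/-- The vertical lift at `u ∈ TM`: a tangent vector `a` at `π(u)` is sent to the velocity at `u` of
the line `t ↦ u + t a` in the fibre, i.e. it is the derivative at `u` of the inclusion of the
fibre. -/
def verticalLift (u : TangentBundle I M) : TangentSpace I u.proj →L[ℝ] TangentSpace I.tangent u :=
  mfderiv 𝓘(ℝ, E) I.tangent (fun a : E => (⟨u.proj, a⟩ : TangentBundle I M)) u.snd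

/-- The mirror map `B` (canonical endomorphism, almost tangent structure) of `T(TM)`: the
differential of the projection followed by the vertical lift. -/
def mirrorMap (u : TangentBundle I M) : TangentSpace I.tangent u →L[ℝ] TangentSpace I.tangent u :=
  (verticalLift I u).comp (mfderiv I.tangent I (fun w : TangentBundle I M => w.proj) u)

variable {I}
variable [I.Boundaryless]

/-- The mirror map in a chart of the tangent manifold induced by a chart of `M`:
`B(∂/∂xʲ) = ∂/∂vʲ` and `B(∂/∂vʲ) = 0`. -/
theorem mirrorMap_chart (u₀ : TangentBundle I M) {y : E × E}
    (hy : y ∈ (extChartAt I.tangent u₀).target) (w : E × E) :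
    mirrorMap I ((extChartAt I.tangent u₀).symm y)
      (mfderiv 𝓘(ℝ, E × E) I.tangent (extChartAt I.tangent u₀).symm y w) =
    mfderiv 𝓘(ℝ, E × E) I.tangent (extChartAt I.tangent u₀).symm y ((0 : E), w.1) := by
  set u : TangentBundle I M := (extChartAt I.tangent u₀).symm y with hu
  have hus : u ∈ (extChartAt I.tangent u₀).source := (extChartAt I.tangent u₀).map_target hy
  have hps : u.proj ∈ (chartAt H u₀.proj).source := by
    rw [extChartAt_source] at hus
    exact (TangentBundle.mem_chart_source_iff u u₀).1 hus
  set T : E →L[ℝ] E := mfderiv I 𝓘(ℝ, E) (extChartAt I u₀.proj) u.proj with hT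
  have hchart : ∀ a : E, extChartAt I.tangent u₀ (⟨u.proj, a⟩ : TangentBundle I M) =
      (extChartAt I u₀.proj u.proj, T a) := by
    intro a
    have h : T = (tangentBundleCore I M).coordChange (achart H u.proj) (achart H u₀.proj) u.proj :=
      (TangentBundle.continuousLinearMapAt_trivializationAt (𝕜 := ℝ) (I := I) hps).symm.trans
        (TangentBundle.continuousLinearMapAt_trivializationAt_eq_core (𝕜 := ℝ) (I := I) hps)
    rw [h]
    rfl
  have hy' : extChartAt I.tangent u₀ u = y := (extChartAt I.tangent u₀).right_inv hy
  have hyT : (y.1, T u.snd) = y := by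
    have h := (hchart u.snd).symm.trans hy'
    have h1 : extChartAt I u₀.proj u.proj = y.1 := congrArg Prod.fst h
    rw [← h1]
    exact h
  have hf : (fun a : E => (⟨u.proj, a⟩ : TangentBundle I M)) =
      (extChartAt I.tangent u₀).symm ∘ fun a : E => (y.1, T a) := by
    funext a
    have hs : (⟨u.proj, a⟩ : TangentBundle I M) ∈ (extChartAt I.tangent u₀).source := by
      rw [extChartAt_source]
      exact (TangentBundle.mem_chart_source_iff _ u₀).2 hps
    have h1 : extChartAt I u₀.proj u.proj = y.1 :=
      congrArg Prod.fst ((hchart u.snd).symm.trans hy')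
    rw [Function.comp_apply, ← h1, ← hchart a]
    exact ((extChartAt I.tangent u₀).left_inv hs).symm
  have hsy : MDifferentiableAt 𝓘(ℝ, E × E) I.tangent (extChartAt I.tangent u₀).symm y :=
    mdifferentiableAt_symm hy
  have hV : ∀ a : E, verticalLift I u a =
      mfderiv 𝓘(ℝ, E × E) I.tangent (extChartAt I.tangent u₀).symm y ((0 : E), T a) := by
    intro a
    have h1 : HasFDerivAt (fun a : E => (y.1, T a)) ((ContinuousLinearMap.inr ℝ E E).comp T)
        u.snd := by
      have h := HasFDerivAt.prodMk (E := E) (x := u.snd) (hasFDerivAt_const y.1 _) T.hasFDerivAt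
      have h' : (ContinuousLinearMap.inr ℝ E E).comp T = ContinuousLinearMap.prod 0 T := rfl
      rw [h']
      exact h
    have h2 : HasMFDerivAt 𝓘(ℝ, E × E) I.tangent (extChartAt I.tangent u₀).symm (y.1, T u.snd)
        (mfderiv 𝓘(ℝ, E × E) I.tangent (extChartAt I.tangent u₀).symm y) := by
      rw [hyT]
      exact hsy.hasMFDerivAt
    have h3 := h2.comp (f := fun a : E => (y.1, T a)) (u.snd : E) h1.hasMFDerivAt
    rw [← hf] at h3
    exact congrArg (fun L : E →L[ℝ] E × E => L a) h3.mfderiv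
  have hπ : T (mfderiv I.tangent I (fun w : TangentBundle I M => w.proj) u
      (mfderiv 𝓘(ℝ, E × E) I.tangent (extChartAt I.tangent u₀).symm y w)) = w.1 := by
    have hp : MDifferentiableAt I.tangent I (fun w : TangentBundle I M => w.proj) u :=
      (contMDiff_proj (n := ∞) (TangentSpace I)).mdifferentiableAt (by simp)
    have hM : MDifferentiableAt I 𝓘(ℝ, E) (extChartAt I u₀.proj) u.proj :=
      mdifferentiableAt_extChartAt hps
    have h1 := (hM.hasMFDerivAt.comp u hp.hasMFDerivAt).comp y hsy.hasMFDerivAt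
    have h2 : (extChartAt I u₀.proj ∘ fun w : TangentBundle I M => w.proj) ∘
        (extChartAt I.tangent u₀).symm =ᶠ[𝓝 y] Prod.fst := by
      filter_upwards [(isOpen_extChartAt_target (I := I.tangent) u₀).mem_nhds hy] with z hz
      have h3 := (extChartAt I.tangent u₀).right_inv hz
      exact congrArg Prod.fst h3
    have h4 : HasMFDerivAt 𝓘(ℝ, E × E) 𝓘(ℝ, E) (Prod.fst : E × E → E) y
        (ContinuousLinearMap.fst ℝ E E) := hasFDerivAt_fst.hasMFDerivAt
    exact congrArg (fun L : E × E →L[ℝ] E => L w)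
      (hasMFDerivAt_unique (h1.congr_of_eventuallyEq h2.symm) h4)
  refine (hV _).trans ?_
  exact congrArg (fun b : E => mfderiv 𝓘(ℝ, E × E) I.tangent (extChartAt I.tangent u₀).symm y
    ((0 : E), b)) hπ

variable (I M) in
/-- The operator `i_B : Ωᵖ(TM) → Ωᵖ(TM)`. -/
def insertB (p : ℕ) : DifferentialForm I.tangent (TangentBundle I M) p →ₗ[ℝ]
    DifferentialForm I.tangent (TangentBundle I M) p where
  toFun α := ⟨fun u => insertEnd (mirrorMap I u) (α.1 u), by
    intro u₀
    have h : ContDiff ℝ ∞ (insertEnd (n := p)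
        ((ContinuousLinearMap.inr ℝ E E).comp (ContinuousLinearMap.fst ℝ E E))) := by
      have : insertEnd (n := p)
          ((ContinuousLinearMap.inr ℝ E E).comp (ContinuousLinearMap.fst ℝ E E)) = fun β =>
          ContinuousAlternatingMap.fderivCompContinuousLinearMapCLM ℝ
            (ContinuousLinearMap.id ℝ (E × E)) β
            ((ContinuousLinearMap.inr ℝ E E).comp (ContinuousLinearMap.fst ℝ E E)) :=
        funext fun β => insertEnd_eq_fderivComp _ β
      rw [this]
      exact (ContinuousLinearMap.contDiff _).clm_apply contDiff_const
    exact (h.comp_contDiffOn (α.2 u₀)).congr fun y hy =>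
      insertEnd_comp _ _ _ (fun w => mirrorMap_chart u₀ hy w) _⟩
  map_add' α β := by
    refine Subtype.ext (funext fun u => ContinuousAlternatingMap.ext fun v => ?_)
    change insertEnd _ (α.1 u + β.1 u) v = insertEnd _ (α.1 u) v + insertEnd _ (β.1 u) v
    simp only [insertEnd_apply, ContinuousAlternatingMap.add_apply, Finset.sum_add_distrib]
  map_smul' c α := by
    refine Subtype.ext (funext fun u => ContinuousAlternatingMap.ext fun v => ?_)
    change insertEnd _ (c • α.1 u) v = c • insertEnd _ (α.1 u) v
    simp only [insertEnd_apply, ContinuousAlternatingMap.smul_apply, Finset.smul_sum]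

variable (I M) in
/-- The derivation `d_B = [i_B, d] = i_B ∘ d - d ∘ i_B : Ωᵖ(TM) → Ωᵖ⁺¹(TM)`. -/
def extDB (p : ℕ) : DifferentialForm I.tangent (TangentBundle I M) p →ₗ[ℝ]
    DifferentialForm I.tangent (TangentBundle I M) (p + 1) :=
  (insertB I M (p + 1)).comp (extD I.tangent (TangentBundle I M) p) -
    (extD I.tangent (TangentBundle I M) p).comp (insertB I M p)

variable (I M) in
/-- The `q`-forms `α` on `TM` with `dα = d_B α = 0`. -/
def bottChernClosed (q : ℕ) : Submodule ℝ (DifferentialForm I.tangent (TangentBundle I M) q) :=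
  LinearMap.ker (extD I.tangent (TangentBundle I M) q) ⊓ LinearMap.ker (extDB I M q)

variable (I M) in
/-- The `q`-forms on `TM` of the form `d d_B τ` with `τ` a `(q-2)`-form. -/
def bottChernExact : (q : ℕ) → Submodule ℝ (DifferentialForm I.tangent (TangentBundle I M) q)
  | 0 => ⊥
  | 1 => ⊥
  | q + 2 => LinearMap.range
      ((extD I.tangent (TangentBundle I M) (q + 1)).comp (extDB I M q))

variable (I M) in
/-- The Bott-Chern type cohomology `H^q_{d d_B}(TM)`. -/
abbrev BottChernCohomology (q : ℕ) : Type _ :=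
  bottChernClosed I M q ⧸ (bottChernExact I M q).submoduleOf (bottChernClosed I M q)

variable (I M) in
/-- The pullback `π^* : Ω^q(M) → Ω^q(TM)` by the projection `π : TM → M`. -/
def pullbackTangent (q : ℕ) :
    DifferentialForm I M q →ₗ[ℝ] DifferentialForm I.tangent (TangentBundle I M) q :=
  pullbackForm (I := I) (J := I.tangent) (f := fun u : TangentBundle I M => u.proj)
    (contMDiff_proj (TangentSpace I)) q

end Tangent
end TangentCohomology

end

/-! The image of `B` is vertical, so `i_B` kills every form that vanishes on vertical vectors, in
particular every `π^*ω`. As `d` commutes with `π^*`, a closed `ω` gives `dπ^*ω = 0`, and then both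
terms of `d_B π^*ω = i_B dπ^*ω - d i_B π^*ω` vanish.

For independence of the representative, let `η` have degree `n + 1` and put `θ_u = u ⌟ π^*η`, the
contraction with the tautological vector (`tautContractForm`). Again `i_B θ = 0`, so `d_B θ = i_B
dθ`. In induced charts the coefficients of `θ` are linear in `v`, and `dθ` consists of terms in the
`dx^i` alone, which `i_B` kills, and terms containing one `dv^j`, which `i_B` turns into `dx^j`.
What remains is `∑ dx^j ∧ (∂_j ⌟ η) = (n + 1) η`, hence `d_B θ = (n + 1) π^*η`
(`extDB_tautContractForm`). Therefore `π^*dη = dπ^*η = d d_B (θ / (n + 1))`. The contraction needs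
`η` of positive degree, which is where `q ≥ 2` enters. -/

noncomputable section
namespace TangentCohomology

/-! ### Tautological contraction on a vector space. -/

section Multilinear

open ContinuousAlternatingMap

variable {V W : Type*} [NormedAddCommGroup V] [NormedSpace ℝ V]
  [NormedAddCommGroup W] [NormedSpace ℝ W] {n : ℕ}

/-- If every `D w` is annihilated by the range of `K`, then contracting the alternatization of `D`
with `K` amounts to precomposing `D` with `K`. -/
theorem insertEnd_alternatizeUncurryFin (K : V →L[ℝ] V) (D : V →L[ℝ] V [⋀^Fin n]→L[ℝ] ℝ)
    (h : ∀ (w u : V) (v : Fin n → V) (i : Fin n), v i = K u → D w v = 0) :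
    insertEnd K (alternatizeUncurryFin D) = alternatizeUncurryFin (D.comp K) := by
  ext v
  rw [insertEnd_apply]
  simp only [alternatizeUncurryFin_apply, ContinuousLinearMap.comp_apply]
  rw [Finset.sum_comm]
  -- Here `i` is the slot used as direction of differentiation and the inner index is the slot hit
  -- by `K`. If they differ, `D` receives an argument in the range of `K` and vanishes; if they
  -- agree, `removeNth` forgets the modified entry.
  refine Finset.sum_congr rfl fun i _ => ?_
  rw [Finset.sum_eq_single i]
  · rw [Function.update_self, Fin.removeNth_update]
  · intro k _ hk
    obtain ⟨j, rfl⟩ := Fin.exists_succAbove_eq hk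
    rw [h _ (v (i.succAbove j)) _ j (by simp [Fin.removeNth]), smul_zero]
  · simp

/-- The contraction `(x, v) ↦ v ⌟ A(x)` of a form on `V` with the tautological vector, as a form
on `V × V`. -/
def tautContract (A : V → V [⋀^Fin (n + 1)]→L[ℝ] ℝ) (y : V × V) : (V × V) [⋀^Fin n]→L[ℝ] ℝ :=
  ((A y.1).curryLeft y.2).compContinuousLinearMap (ContinuousLinearMap.fst ℝ V V)

/-- Exhibits the contraction as continuous linear maps applied to `A y.1` and `y.2`, so that
smoothness follows from the standard calculus rules. -/
theorem tautContract_eq (A : V → V [⋀^Fin (n + 1)]→L[ℝ] ℝ) :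
    tautContract A = fun y => compContinuousLinearMapCLM (ContinuousLinearMap.fst ℝ V V)
      ((curryLeftLI (𝕜 := ℝ) (E := V) (F := ℝ) (n := n)).toContinuousLinearMap (A y.1) y.2) := rfl

theorem contDiffOn_tautContract {A : V → V [⋀^Fin (n + 1)]→L[ℝ] ℝ} {s : Set V}
    (hA : ContDiffOn ℝ ∞ A s) {t : Set (V × V)} (ht : ∀ y ∈ t, y.1 ∈ s) :
    ContDiffOn ℝ ∞ (tautContract A) t := by
  rw [tautContract_eq]
  refine (ContinuousLinearMap.contDiff _).comp_contDiffOn (ContDiffOn.clm_apply ?_ ?_)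
  · exact (ContinuousLinearMap.contDiff _).comp_contDiffOn (hA.comp contDiffOn_fst ht)
  · exact contDiffOn_snd

/-- `d_B (v ⌟ A) = (n + 1) π^* A` on `V × V`. -/
theorem insertEnd_extDeriv_tautContract {A : V → V [⋀^Fin (n + 1)]→L[ℝ] ℝ} {y : V × V}
    (hA : DifferentiableAt ℝ A y.1) :
    insertEnd ((ContinuousLinearMap.inr ℝ V V).comp (ContinuousLinearMap.fst ℝ V V))
      (extDeriv (tautContract A) y) =
      ((n + 1 : ℕ) : ℝ) • (A y.1).compContinuousLinearMap (ContinuousLinearMap.fst ℝ V V) := by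
  have h := HasFDerivAt.comp y hA.hasFDerivAt (hasFDerivAt_fst (𝕜 := ℝ) (p := y))
  have hc := ContinuousLinearMap.hasFDerivAt (𝕜 := ℝ) (E := V [⋀^Fin (n + 1)]→L[ℝ] ℝ)
    (F := V →L[ℝ] V [⋀^Fin n]→L[ℝ] ℝ) (curryLeftLI (𝕜 := ℝ) (E := V) (F := ℝ)
      (n := n)).toContinuousLinearMap (x := A y.1)
  have h0 := HasFDerivAt.comp (F := V [⋀^Fin (n + 1)]→L[ℝ] ℝ)
    (G := V →L[ℝ] V [⋀^Fin n]→L[ℝ] ℝ) (f := fun z : V × V => A z.1) y hc h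
  -- Product rule: one term differentiates `A` along the base, the other differentiates the
  -- tautological vector. Precomposition with `(x, v) ↦ (0, x)` will kill the first.
  have h1 := HasFDerivAt.clm_apply h0 (hasFDerivAt_snd (𝕜 := ℝ) (p := y))
  have h2 := (compContinuousLinearMapCLM (F := ℝ) (ι := Fin n)
    (ContinuousLinearMap.fst ℝ V V)).hasFDerivAt.comp y h1
  have h3 : HasFDerivAt (tautContract A) _ y := h2
  rw [extDeriv, h3.fderiv, insertEnd_alternatizeUncurryFin]
  · have h4 : ((A y.1).compContinuousLinearMap (ContinuousLinearMap.fst ℝ V V)).curryLeft =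
        (compContinuousLinearMapCLM (ContinuousLinearMap.fst ℝ V V)).comp
          ((A y.1).curryLeft.comp (ContinuousLinearMap.fst ℝ V V)) := by
      refine ContinuousLinearMap.ext fun w => ?_
      exact curryLeft_compContinuousLinearMap _ _ _
    -- The factor `n + 1` arises because alternatizing the curried form of an alternating `(n +
    -- 1)`-form multiplies it by `n + 1`.
    rw [Nat.cast_smul_eq_nsmul, ← alternatizeUncurryFin_curryLeft, h4]
    congr 1
    refine ContinuousLinearMap.ext fun w => ContinuousAlternatingMap.ext fun v => ?_
    simp
  · intro w u v i hi
    rw [ContinuousLinearMap.comp_apply, compContinuousLinearMapCLM_apply,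
      compContinuousLinearMap_apply]
    refine ContinuousAlternatingMap.map_coord_zero _ i ?_
    simp [hi]

end Multilinear

/-! ### Recovering a form from its chart expressions. -/

section Forms

variable {E : Type*} [NormedAddCommGroup E] [NormedSpace ℝ E]
  {H : Type*} [TopologicalSpace H] {I : ModelWithCorners ℝ E H}
  {M : Type*} [TopologicalSpace M] [ChartedSpace H M] [IsManifold I ∞ M] [I.Boundaryless] {n : ℕ}

theorem mfderiv_symm_mfderiv_extChartAt {x₀ x : M} (hx : x ∈ (extChartAt I x₀).source) (a : E) :
    (mfderiv 𝓘(ℝ, E) I (extChartAt I x₀).symm (extChartAt I x₀ x)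
      ((mfderiv I 𝓘(ℝ, E) (extChartAt I x₀) x : E →L[ℝ] E) a) : E) = a := by
  have h := mfderivWithin_extChartAt_symm_comp_mfderiv_extChartAt' hx
  rw [I.range_eq_univ, mfderivWithin_univ] at h
  exact congrArg (fun L : E →L[ℝ] E => L a) h

/-- A field of forms is determined by its expressions in charts. -/
theorem form_ext {α β : ∀ x : M, TangentSpace I x [⋀^Fin n]→L[ℝ] ℝ}
    (h : ∀ x : M, ∀ y ∈ (extChartAt I x).target, chartRep I x α y = chartRep I x β y) :
    α = β := by
  -- Pulling the chart expression back by the derivative of the chart undoes the pullback by the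
  -- inverse chart, so the chart centred at `x` alone determines the value at `x`.
  have key : ∀ (γ : ∀ x : M, TangentSpace I x [⋀^Fin n]→L[ℝ] ℝ) (x : M) (v : Fin n → E),
      (γ x : E [⋀^Fin n]→L[ℝ] ℝ) v = chartRep I x γ (extChartAt I x x)
        fun i => (mfderiv I 𝓘(ℝ, E) (extChartAt I x) x : E →L[ℝ] E) (v i) := by
    intro γ x v
    refine (apply_congr_point (extChartAt_to_inv (I := I) x).symm γ v).trans ?_
    exact congrArg (γ _ : E [⋀^Fin n]→L[ℝ] ℝ)
      (funext fun i => (mfderiv_symm_mfderiv_extChartAt (mem_extChartAt_source x) (v i)).symm)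
  funext x
  refine ContinuousAlternatingMap.ext fun v => ?_
  refine (key α x v).trans (Eq.trans ?_ (key β x v).symm)
  rw [h x _ (mem_extChartAt_target x)]

end Forms

/-! ### The projection and the mirror map in induced charts. -/

section Tangent

variable {E : Type*} [NormedAddCommGroup E] [NormedSpace ℝ E]
  {H : Type*} [TopologicalSpace H] {I : ModelWithCorners ℝ E H}
  {M : Type*} [TopologicalSpace M] [ChartedSpace H M] [IsManifold I ∞ M]

theorem proj_mem_chart_source {u₀ : TangentBundle I M} {y : E × E}
    (hy : y ∈ (extChartAt I.tangent u₀).target) :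
    ((extChartAt I.tangent u₀).symm y).proj ∈ (chartAt H u₀.proj).source := by
  have hus := (extChartAt I.tangent u₀).map_target hy
  rw [extChartAt_source] at hus
  exact (TangentBundle.mem_chart_source_iff _ u₀).1 hus

theorem extChartAt_proj_symm {u₀ : TangentBundle I M} {y : E × E}
    (hy : y ∈ (extChartAt I.tangent u₀).target) :
    extChartAt I u₀.proj ((extChartAt I.tangent u₀).symm y).proj = y.1 :=
  congrArg Prod.fst ((extChartAt I.tangent u₀).right_inv hy)

theorem fst_mem_target {u₀ : TangentBundle I M} {y : E × E}
    (hy : y ∈ (extChartAt I.tangent u₀).target) : y.1 ∈ (extChartAt I u₀.proj).target := by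
  rw [← extChartAt_proj_symm hy]
  exact (extChartAt I u₀.proj).map_source (by simpa using proj_mem_chart_source hy)

theorem proj_extChartAt_symm {u₀ : TangentBundle I M} {y : E × E}
    (hy : y ∈ (extChartAt I.tangent u₀).target) :
    ((extChartAt I.tangent u₀).symm y).proj = (extChartAt I u₀.proj).symm y.1 := by
  rw [← extChartAt_proj_symm hy]
  exact ((extChartAt I u₀.proj).left_inv (by simpa using proj_mem_chart_source hy)).symm

variable [I.Boundaryless]

/-- The fibre coordinate of an induced chart is the derivative of the base chart applied to the
vector; inverting that derivative gives the formula. -/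
theorem snd_extChartAt_symm {u₀ : TangentBundle I M} {y : E × E}
    (hy : y ∈ (extChartAt I.tangent u₀).target) :
    (((extChartAt I.tangent u₀).symm y).snd : E) =
      mfderiv 𝓘(ℝ, E) I (extChartAt I u₀.proj).symm y.1 y.2 := by
  set u := (extChartAt I.tangent u₀).symm y with hu
  have hps : u.proj ∈ (chartAt H u₀.proj).source := proj_mem_chart_source hy
  have h : (mfderiv I 𝓘(ℝ, E) (extChartAt I u₀.proj) u.proj : E →L[ℝ] E) =
      (tangentBundleCore I M).coordChange (achart H u.proj) (achart H u₀.proj) u.proj :=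
    (TangentBundle.continuousLinearMapAt_trivializationAt (𝕜 := ℝ) (I := I) hps).symm.trans
      (TangentBundle.continuousLinearMapAt_trivializationAt_eq_core (𝕜 := ℝ) (I := I) hps)
  have h2 : (mfderiv I 𝓘(ℝ, E) (extChartAt I u₀.proj) u.proj : E →L[ℝ] E) u.snd = y.2 := by
    rw [h]
    exact congrArg Prod.snd ((extChartAt I.tangent u₀).right_inv hy)
  have h3 := mfderiv_symm_mfderiv_extChartAt (I := I) (x₀ := u₀.proj) (by simpa using hps)
    (u.snd : E)
  rw [h2, extChartAt_proj_symm hy] at h3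
  exact h3.symm

/-- In induced charts `π` reads as `Prod.fst`; this is the chain rule applied to that identity near
`y`. -/
theorem mfderiv_proj_mfderiv_symm {u₀ : TangentBundle I M} {y : E × E}
    (hy : y ∈ (extChartAt I.tangent u₀).target) (w : E × E) :
    (mfderiv I.tangent I (fun u : TangentBundle I M => u.proj) ((extChartAt I.tangent u₀).symm y)
      (mfderiv 𝓘(ℝ, E × E) I.tangent (extChartAt I.tangent u₀).symm y w) : E) =
      mfderiv 𝓘(ℝ, E) I (extChartAt I u₀.proj).symm y.1 w.1 := by
  have hp : MDifferentiableAt I.tangent I (fun w : TangentBundle I M => w.proj)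
      ((extChartAt I.tangent u₀).symm y) :=
    (contMDiff_proj (n := ∞) (TangentSpace I)).mdifferentiableAt (by simp)
  have h1 := hp.hasMFDerivAt.comp y (mdifferentiableAt_symm hy).hasMFDerivAt
  have h4 : HasMFDerivAt 𝓘(ℝ, E × E) 𝓘(ℝ, E) (Prod.fst : E × E → E) y
      (ContinuousLinearMap.fst ℝ E E) := hasFDerivAt_fst.hasMFDerivAt
  have h5 := (mdifferentiableAt_symm (fst_mem_target hy)).hasMFDerivAt.comp y h4
  have h2 : (fun w : TangentBundle I M => w.proj) ∘ (extChartAt I.tangent u₀).symm =ᶠ[𝓝 y]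
      (extChartAt I u₀.proj).symm ∘ Prod.fst := by
    filter_upwards [(isOpen_extChartAt_target (I := I.tangent) u₀).mem_nhds hy] with z hz
    exact proj_extChartAt_symm hz
  exact congrArg (fun L : E × E →L[ℝ] E => L w)
    (hasMFDerivAt_unique h1 (h5.congr_of_eventuallyEq h2))

theorem chartRep_pullbackTangent {n : ℕ} (α : DifferentialForm I M n) {u₀ : TangentBundle I M}
    {y : E × E} (hy : y ∈ (extChartAt I.tangent u₀).target) :
    chartRep I.tangent u₀ (pullbackTangent I M n α).1 y =
      (chartRep I u₀.proj α.1 y.1).compContinuousLinearMap (ContinuousLinearMap.fst ℝ E E) := by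
  ext v
  refine Eq.trans ?_ (apply_congr_point (proj_extChartAt_symm hy) α.1 _)
  exact congrArg (α.1 _ : E [⋀^Fin n]→L[ℝ] ℝ)
    (funext fun i => mfderiv_proj_mfderiv_symm hy (v i))

theorem chartRep_insertB {n : ℕ} (β : DifferentialForm I.tangent (TangentBundle I M) n)
    {u₀ : TangentBundle I M} {y : E × E} (hy : y ∈ (extChartAt I.tangent u₀).target) :
    chartRep I.tangent u₀ (insertB I M n β).1 y =
      insertEnd ((ContinuousLinearMap.inr ℝ E E).comp (ContinuousLinearMap.fst ℝ E E))
        (chartRep I.tangent u₀ β.1 y) :=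
  insertEnd_comp _ _ _ (fun w => mirrorMap_chart u₀ hy w) _

/-! ### The tautological contraction on the tangent bundle. -/

variable (I M) in
/-- The contraction `u ↦ u ⌟ π^* α` of the pullback of a field of forms with the tautological
vector. -/
def tautContractField {n : ℕ} (α : ∀ x : M, TangentSpace I x [⋀^Fin (n + 1)]→L[ℝ] ℝ)
    (u : TangentBundle I M) : TangentSpace I.tangent u [⋀^Fin n]→L[ℝ] ℝ :=
  (ContinuousAlternatingMap.curryLeft (𝕜 := ℝ) (E := E) (α u.proj) u.snd).compContinuousLinearMap
    (mfderiv I.tangent I (fun w : TangentBundle I M => w.proj) u : E × E →L[ℝ] E)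

theorem chartRep_tautContractField {n : ℕ}
    (α : ∀ x : M, TangentSpace I x [⋀^Fin (n + 1)]→L[ℝ] ℝ) {u₀ : TangentBundle I M}
    {y : E × E} (hy : y ∈ (extChartAt I.tangent u₀).target) :
    chartRep I.tangent u₀ (tautContractField I M α) y =
      tautContract (chartRep I u₀.proj α) y := by
  ext v
  refine Eq.trans ?_ (apply_congr_point (proj_extChartAt_symm hy) α _)
  refine congrArg (α _ : E [⋀^Fin (n + 1)]→L[ℝ] ℝ) (funext fun i => ?_)
  -- Slot `0` holds the tautological vector `u`, read through its fibre coordinate; the other slots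
  -- hold projected tangent vectors.
  cases i using Fin.cases with
  | zero => exact snd_extChartAt_symm hy
  | succ i => exact mfderiv_proj_mfderiv_symm hy (v i)

variable (I M) in
/-- The contraction of `π^* α` with the tautological vector, as a smooth form on `TM`. -/
def tautContractForm (n : ℕ) (α : DifferentialForm I M (n + 1)) :
    DifferentialForm I.tangent (TangentBundle I M) n :=
  ⟨tautContractField I M α.1, fun u₀ =>
    (contDiffOn_tautContract (α.2 u₀.proj) fun _ hy => fst_mem_target hy).congr
      fun _ hy => chartRep_tautContractField α.1 hy⟩

theorem differentiableAt_chartRep_fst {n : ℕ} (α : DifferentialForm I M n)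
    {u₀ : TangentBundle I M} {y : E × E} (hy : y ∈ (extChartAt I.tangent u₀).target) :
    DifferentiableAt ℝ (chartRep I u₀.proj α.1) y.1 :=
  ((α.2 u₀.proj y.1 (fst_mem_target hy)).contDiffAt
    ((isOpen_extChartAt_target u₀.proj).mem_nhds (fst_mem_target hy))).differentiableAt (by simp)

/-! ### The operators `d`, `i_B` and `d_B` on pulled back and contracted forms. -/

/-- Pullback to the tangent bundle commutes with the exterior derivative. -/
theorem extD_pullbackTangent {n : ℕ} (α : DifferentialForm I M n) :
    extD I.tangent (TangentBundle I M) n (pullbackTangent I M n α) =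
      pullbackTangent I M (n + 1) (extD I M n α) := by
  refine Subtype.ext (form_ext fun u₀ y hy => ?_)
  rw [chartRep_pullbackTangent _ hy]
  refine (chartRep_extDerivAt (pullbackTangent I M n α).2 u₀ hy).trans ?_
  -- The constant map `fst` is written as the derivative of `Prod.fst` to match the shape required
  -- by `extDeriv_pullback`.
  have hev : chartRep I.tangent u₀ (pullbackTangent I M n α).1 =ᶠ[𝓝 y] fun z =>
      (chartRep I u₀.proj α.1 z.1).compContinuousLinearMap
        (fderiv ℝ (Prod.fst : E × E → E) z) := by
    filter_upwards [(isOpen_extChartAt_target (I := I.tangent) u₀).mem_nhds hy] with z hz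
    rw [fderiv_fst]
    exact chartRep_pullbackTangent α hz
  refine hev.extDeriv_eq.trans ?_
  rw [extDeriv_pullback (r := ∞) (differentiableAt_chartRep_fst α hy) contDiffAt_fst
    (by rw [minSmoothness_of_isRCLikeNormedField]; exact WithTop.coe_le_coe.2 le_top),
    fderiv_fst]
  exact congrArg (fun β : E [⋀^Fin (n + 1)]→L[ℝ] ℝ =>
    β.compContinuousLinearMap (ContinuousLinearMap.fst ℝ E E))
    (chartRep_extDerivAt α.2 u₀.proj (fst_mem_target hy)).symm

/-- Each summand has an argument of the form `(0, x)`, which `fst` sends to zero. -/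
theorem insertEnd_compContinuousLinearMap_fst {n : ℕ} (β : E [⋀^Fin n]→L[ℝ] ℝ) :
    insertEnd ((ContinuousLinearMap.inr ℝ E E).comp (ContinuousLinearMap.fst ℝ E E))
      (β.compContinuousLinearMap (ContinuousLinearMap.fst ℝ E E)) = 0 := by
  ext v
  rw [insertEnd_apply]
  refine Finset.sum_eq_zero fun i _ => ContinuousAlternatingMap.map_coord_zero β i ?_
  simp

theorem insertB_pullbackTangent {n : ℕ} (α : DifferentialForm I M n) :
    insertB I M n (pullbackTangent I M n α) = 0 := by
  refine Subtype.ext (form_ext fun u₀ y hy => ?_)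
  rw [chartRep_insertB _ hy, chartRep_pullbackTangent _ hy]
  exact insertEnd_compContinuousLinearMap_fst _

theorem insertB_tautContractForm {n : ℕ} (α : DifferentialForm I M (n + 1)) :
    insertB I M n (tautContractForm I M n α) = 0 := by
  refine Subtype.ext (form_ext fun u₀ y hy => ?_)
  rw [chartRep_insertB _ hy]
  refine (congrArg _ (chartRep_tautContractField α.1 hy)).trans ?_
  exact insertEnd_compContinuousLinearMap_fst _

/-- A pulled back form of positive degree is `d_B`-exact up to a nonzero factor. -/
theorem extDB_tautContractForm {n : ℕ} (α : DifferentialForm I M (n + 1)) :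
    extDB I M n (tautContractForm I M n α) =
      ((n + 1 : ℕ) : ℝ) • pullbackTangent I M (n + 1) α := by
  -- The contraction is itself annihilated by `i_B`, so only `i_B d` survives in `d_B`.
  rw [extDB, LinearMap.sub_apply, LinearMap.comp_apply, LinearMap.comp_apply,
    insertB_tautContractForm, map_zero, sub_zero]
  refine Subtype.ext (form_ext fun u₀ y hy => ?_)
  rw [chartRep_insertB _ hy]
  have hev : chartRep I.tangent u₀ (tautContractForm I M n α).1 =ᶠ[𝓝 y]
      tautContract (chartRep I u₀.proj α.1) := by
    filter_upwards [(isOpen_extChartAt_target (I := I.tangent) u₀).mem_nhds hy] with z hz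
    exact chartRep_tautContractField α.1 hz
  have h1 := (chartRep_extDerivAt (tautContractForm I M n α).2 u₀ hy).trans hev.extDeriv_eq
  refine (congrArg _ h1).trans ?_
  rw [insertEnd_extDeriv_tautContract (differentiableAt_chartRep_fst α hy),
    ← chartRep_pullbackTangent α hy]
  rfl

/-! ### Passage to cohomology. -/

theorem pullbackTangent_mem_bottChernClosed {n : ℕ} {α : DifferentialForm I M n}
    (hα : α ∈ closedForms I M n) : pullbackTangent I M n α ∈ bottChernClosed I M n := by
  have h : extD I.tangent (TangentBundle I M) n (pullbackTangent I M n α) = 0 := by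
    rw [extD_pullbackTangent, LinearMap.mem_ker.1 hα, map_zero]
  refine ⟨h, ?_⟩
  rw [SetLike.mem_coe, LinearMap.mem_ker, extDB, LinearMap.sub_apply, LinearMap.comp_apply,
    LinearMap.comp_apply, h, insertB_pullbackTangent, map_zero, map_zero, sub_zero]

theorem pullbackTangent_mem_bottChernExact {n : ℕ} {α : DifferentialForm I M (n + 2)}
    (hα : α ∈ exactForms I M (n + 2)) :
    pullbackTangent I M (n + 2) α ∈ bottChernExact I M (n + 2) := by
  obtain ⟨η, rfl⟩ := hα
  -- The primitive `η` has degree `n + 1`; the scalar cancels the factor in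
  -- `extDB_tautContractForm`.
  refine ⟨((n + 1 : ℕ) : ℝ)⁻¹ • tautContractForm I M n η, ?_⟩
  rw [map_smul, LinearMap.comp_apply, extDB_tautContractForm, map_smul, smul_smul,
    inv_mul_cancel₀ (by positivity), one_smul, extD_pullbackTangent]

variable (I M) in
/-- The map `[ω] ↦ [π^* ω]` from de Rham cohomology to Bott-Chern type cohomology. -/
def pullbackCohomology (n : ℕ) :
    DeRhamCohomology I M (n + 2) →ₗ[ℝ] BottChernCohomology I M (n + 2) :=
  Submodule.mapQ _ _
    ((pullbackTangent I M (n + 2)).restrict fun _ hα => pullbackTangent_mem_bottChernClosed hα)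
    fun _ hα => pullbackTangent_mem_bottChernExact hα

end Tangent
end TangentCohomology
end

/-- Well-definedness is expressed as existence of a linear map with the prescribed values on
representatives; uniqueness holds because every class has a representative. -/
theorem mainTheorem4 (m : ℕ) (M : Type*) [TopologicalSpace M]
    [ChartedSpace (EuclideanSpace ℝ (Fin m)) M] [IsManifold (𝓡 m) ∞ M] (q : ℕ) (hq : 2 ≤ q) :
    ∃! Φ : TangentCohomology.DeRhamCohomology (𝓡 m) M q →ₗ[ℝ]
        TangentCohomology.BottChernCohomology (𝓡 m) M q,
      ∀ α : TangentCohomology.closedForms (𝓡 m) M q,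
        ∃ h : TangentCohomology.pullbackTangent (𝓡 m) M q α ∈
            TangentCohomology.bottChernClosed (𝓡 m) M q,
          Φ (Submodule.Quotient.mk α) =
            Submodule.Quotient.mk ⟨TangentCohomology.pullbackTangent (𝓡 m) M q α, h⟩ := by
  -- Writing the degree as `n + 2` selects the branches of `exactForms` and `bottChernExact` given
  -- by ranges.
  obtain ⟨n, rfl⟩ := Nat.exists_eq_add_of_le' hq
  refine ⟨TangentCohomology.pullbackCohomology (𝓡 m) M n, fun α =>
    ⟨TangentCohomology.pullbackTangent_mem_bottChernClosed α.2, rfl⟩, fun Ψ hΨ => ?_⟩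
  refine LinearMap.ext fun c => ?_
  obtain ⟨α, rfl⟩ := Submodule.Quotient.mk_surjective _ c
  obtain ⟨_, h⟩ := hΨ α
  exact h
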